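/- Let $G$ be a finite group, $A$ a finite abelian group and $\rho: G \to \mathrm{Aut}(A)$ an action, i.e. a finite split 2-group $\mathcal{G} = (G,A,\rho)$. **Definitions.** A 2-representation of $\mathcal{G}$ is a triple $(\sigma,c,\chi)$ of an action $\sigma$ of $G$ on a finite set $I$, a map $c: G\times G \to U(1)^I$ with $c_{\sigma_g^{-1}(i)}(h,k)\, c_i(g,hk) = c_i(gh,k)\, c_i(g,h)$, and characters $\chi_i$ of $A$ ($i\in I$) with $\chi_{\sigma_g^{-1}(i)}(a) = \chi_i(\rho_g a)$. The product $(\sigma,c,\chi)\otimes(\sigma',c',\chi')$ is given on $I \times I'$ by the product action and the products $c_i c'_{j}$, $\chi_i\chi'_j$; the unit is $\mathbf 1 = (1,1,1)$ on a one-point set. A 1-morphism $(\sigma,c,\chi) \to (\sigma',c',\chi')$ is a family $\mathcal V$ of finite-dimensional complex vector spaces $\mathcal V_{(i,j)}$, $(i,j)\in I\times I'$, with linear isomorphisms $\Phi_g : \mathcal V_{(i,j)} \to \mathcal V_{(\sigma_g(i),\sigma'_g(j))}$ such that $\Phi_{gh} = \overline{c_i(g,h)}\,c'_j(g,h)\,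 \Phi_g \Phi_h$ with values in the fibre at $(i,j)$, and with $\mathcal V_{(i,j)} = 0$ unless $\chi_i = \chi'_j$; two 1-morphisms are isomorphic if there are linear isomorphisms between their fibres at each $(i,j)$ commuting with all $\Phi_g$. The fusion of 1-morphisms is the fibrewise tensor product with the tensor product action. The identity 1-morphism has fibre $\mathbb C$ at each $(i,i)$, fibre $0$ elsewhere, and $\Phi_g$ acts as $1:\mathbb C\to\mathbb C$. A finite-dimensional representation $\psi: G\to \mathrm{GL}(W)$ is a 1-endomorphism of $\mathbf 1$, so that, via $X\otimes\mathbf 1\cong X$, the fusion of $\varphi: X\to Y$ with $\psi$ is again a 1-morphism $\varphi\otimes\psi: X\to Y$. For a subgroup $H\subset G$, a 2-cocycle $u: H\times H\to U(1)$ and an $H$-invariant character $\alpha$ of $A$, the simple 2-representation $(H,u,\alpha)$ is the induced one: choosing representatives $R_x$ of the cosets $x\in G/H$ and writing $gR_x = R_{gx}h_x(g)$, it is given on $G/H$ by left translation, $c_x(g,g') = u(h_{g^{-1}x}(g), h_{(gg')^{-1}x}(g'))$ and $\chi_x(a) = \alpha(\rho_{R_x}^{-1}a)$. For a 1-morphism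 $\varphi=(\mathcal V,\Phi): (H,u,\alpha)\to (K,v,\beta)$ and $g\in G$, its component $\varphi_g$ is the projective representation of $H\cap gKg^{-1}$ (the stabiliser of $(eH,gK)$) with 2-cocycle $(l,l')\mapsto\overline{u(l,l')}\,v(g^{-1}lg,g^{-1}l'g)$ on the fibre $\mathcal V_{(eH,gK)}$ given by $$\varphi_g(l) = \frac{\gamma^v_{s}(g^{-1}lg)}{\gamma^u_{r}(l)}\;\Phi_l, \qquad \gamma^w_{t}(h) := \frac{w(t,t^{-1}ht)}{w(h,t)}, \qquad r = R_{eH}\in H,\quad s = g^{-1}S_{gK}\in K,$$ where $S$ are the chosen representatives of $G/K$ (the prefactor is $1$ if $R_{eH}=e$ and $S_{gK}=g$). **Proposition (absorption of Wilson lines).** Let $(H,u,\alpha)$ and $(K,v,\beta)$ be simple 2-representations of $\mathcal G$, built with arbitrary coset representatives, let $\varphi : (H,u,\alpha)\to(K,v,\beta)$ be a 1-morphism, and let $\psi: G\to\mathrm{GL}(W)$ be a finite-dimensional complex representation, viewed as a 1-endomorphism of $\mathbf 1$. Then for every $g\in G$ there is an isomorphism of projective representations of $H\cap gKg^{-1}$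 $$(\varphi\otimes\psi)_g \;\cong\; \varphi_g\otimes \mathrm{Res}^G_{H\cap gKg^{-1}}(\psi),$$ and $\varphi\otimes\psi$ is determined by these components: if $g$ runs through any system of representatives of the double cosets $H\backslash G/K$ and $\theta : (H,u,\alpha)\to(K,v,\beta)$ is a 1-morphism with $\theta_g\cong\varphi_g\otimes \mathrm{Res}^G_{H\cap gKg^{-1}}(\psi)$ for all these $g$, then $\theta\cong\varphi\otimes\psi$. In particular, for the identity 1-morphism of $(H,u,\alpha)$ one has $(\mathrm{Id}_{(H,u,\alpha)}\otimes\psi)_e\cong\mathrm{Res}^G_H(\psi)$ as representations of $H$, and $(\mathrm{Id}_{(H,u,\alpha)}\otimes\psi)_g = 0$ for all $g\notin H$. -/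

import Mathlib

open scoped TensorProduct

universe u

/-! ## 2-representations of a finite split 2-group `(G, A, ρ)` -/

/-- A 2-representation of the split 2-group `(G, A, ρ)` whose underlying finite set is `ι` (its
dimension is the cardinality of `ι`): a triple `(σ, c, χ)` of a permutation action `σ` of `G` on
`ι`, a `σ`-twisted 2-cocycle `c` on `G` with values in `U(1)^ι`, and a family `χ` of characters
of `A` such that `χ_{σ_g⁻¹ i}(a) = χ_i(g ▷ a)`. -/
structure TwoRep {G A : Type*} [Group G] [CommGroup A] (ρ : G →* MulAut A) (ι : Type*) where
  finite_index : Finite ι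
  σ : G →* Equiv.Perm ι
  c : G → G → ι → Circle
  cocycle : ∀ g h k i, c h k ((σ g)⁻¹ i) * c g (h * k) i = c (g * h) k i * c g h i
  χ : ι → (A →* Circle)
  equivariant : ∀ g a i, χ ((σ g)⁻¹ i) a = χ i (ρ g a)

/-- The permutation action `σ ⊗ τ` on a product. -/
def prodPerm {G ι κ : Type*} [Group G] (σ : G →* Equiv.Perm ι) (τ : G →* Equiv.Perm κ) :
    G →* Equiv.Perm (ι × κ) where
  toFun g := Equiv.prodCongr (σ g) (τ g)
  map_one' := by ext p <;> simp
  map_mul' g h := by ext p <;> simp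

namespace TwoRep

variable {G A : Type*} [Group G] [CommGroup A] {ρ : G →* MulAut A}
variable {ι κ ι' κ' : Type*}

/-- The trivial 2-representation `𝟏 = (1, 1, 1)`. -/
noncomputable def trivial (ρ : G →* MulAut A) : TwoRep ρ Unit where
  finite_index := inferInstance
  σ := 1
  c _ _ _ := 1
  cocycle := by simp
  χ _ := 1
  equivariant := by simp

/-- The conjugate `(σ, c̄, χ̄)`; complex conjugation on `U(1)` is inversion. -/
noncomputable def conj (X : TwoRep ρ ι) : TwoRep ρ ι where
  finite_index := X.finite_index
  σ := X.σ
  c g h i := (X.c g h i)⁻¹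
  cocycle g h k i := by
    rw [← mul_inv, ← mul_inv, X.cocycle]
  χ i := (X.χ i)⁻¹
  equivariant g a i := congrArg (·⁻¹) (X.equivariant g a i)

/-- The tensor product `(σ ⊗ σ', c ⊗ c', χ ⊗ χ')` of 2-representations. -/
noncomputable def tensor (X : TwoRep ρ ι) (Y : TwoRep ρ κ) : TwoRep ρ (ι × κ) where
  finite_index := by
    have := X.finite_index
    have := Y.finite_index
    infer_instance
  σ := prodPerm X.σ Y.σ
  c g h p := X.c g h p.1 * Y.c g h p.2
  cocycle g h k p := by
    have hX := X.cocycle g h k p.1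
    have hY := Y.cocycle g h k p.2
    calc _ = (X.c h k ((X.σ g)⁻¹ p.1) * X.c g (h * k) p.1)
          * (Y.c h k ((Y.σ g)⁻¹ p.2) * Y.c g (h * k) p.2) := mul_mul_mul_comm _ _ _ _
      _ = _ := by rw [hX, hY]; exact mul_mul_mul_comm _ _ _ _
  χ p := X.χ p.1 * Y.χ p.2
  equivariant g a p := by
    have hX := X.equivariant g a p.1
    have hY := Y.equivariant g a p.2
    exact congrArg₂ (· * ·) hX hY

/-- A relabelling of the underlying set that matches `σ`, `c` and `χ` strictly. -/
structure StrictIso (X : TwoRep ρ ι) (Y : TwoRep ρ κ) where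
  toEquiv : ι ≃ κ
  σ_comm : ∀ g i, toEquiv (X.σ g i) = Y.σ g (toEquiv i)
  c_comm : ∀ g h i, Y.c g h (toEquiv i) = X.c g h i
  χ_comm : ∀ i, Y.χ (toEquiv i) = X.χ i

/-- The canonical identification `X ⊗ 𝟏 ≅ X`. -/
noncomputable def rightUnitor (X : TwoRep ρ ι) : StrictIso (X.tensor (trivial ρ)) X where
  toEquiv := Equiv.prodPUnit ι
  σ_comm _ _ := rfl
  c_comm g h p := (mul_one (X.c g h p.1)).symm
  χ_comm p := (mul_one (X.χ p.1)).symm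

end TwoRep

/-! ## Graded projective representations -/

theorem tensorProduct_subsingleton_left (M N : Type*) [AddCommGroup M] [AddCommGroup N]
    [Module ℂ M] [Module ℂ N] [Subsingleton M] : Subsingleton (M ⊗[ℂ] N) := by
  refine subsingleton_of_forall_eq 0 (fun x => ?_)
  induction x using TensorProduct.induction_on with
  | zero => rfl
  | add x y hx hy => rw [hx, hy, add_zero]
  | tmul x y => rw [Subsingleton.elim x 0, TensorProduct.zero_tmul]

theorem tensorProduct_subsingleton_right (M N : Type*) [AddCommGroup M] [AddCommGroup N]
    [Module ℂ M] [Module ℂ N] [Subsingleton N] : Subsingleton (M ⊗[ℂ] N) := by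
  refine subsingleton_of_forall_eq 0 (fun x => ?_)
  induction x using TensorProduct.induction_on with
  | zero => rfl
  | add x y hx hy => rw [hx, hy, add_zero]
  | tmul x y => rw [Subsingleton.elim y 0, TensorProduct.tmul_zero]


/-- A graded projective representation of `G` with obstruction pair `(σ, c)`: a finite-rank complex
vector bundle over the set `ι`, that is a family of finite-dimensional fibres, with bundle
automorphisms `Φ_g` covering `σ_g` such that `Φ_{gh} = c(g,h) ∘ Φ_g ∘ Φ_h`, where `c(g,h)` scales
the fibre at `k` by `c_k(g,h)`. The restriction of `Φ_g` to the fibre at `i` is recorded as a map to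
the fibre at `j`, for every `j` that equals `σ_g(i)`. -/
structure GradedProjRep {G : Type*} [Group G] {ι : Type*} (σ : G →* Equiv.Perm ι)
    (c : G → G → ι → Circle) where
  fibre : ι → Type u
  [addCommGroup : ∀ i, AddCommGroup (fibre i)]
  [module : ∀ i, Module ℂ (fibre i)]
  [finiteDimensional : ∀ i, FiniteDimensional ℂ (fibre i)]
  Φ : ∀ (g : G) {i j : ι}, σ g i = j → (fibre i ≃ₗ[ℂ] fibre j)
  Φ_mul : ∀ (g h : G) {i j k : ι} (hi : σ h i = j) (hj : σ g j = k) (hk : σ (g * h) i = k)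
    (x : fibre i), Φ (g * h) hk x = ((c g h k : Circle) : ℂ) • Φ g hj (Φ h hi x)

attribute [instance] GradedProjRep.addCommGroup GradedProjRep.module
  GradedProjRep.finiteDimensional

namespace GradedProjRep

variable {G : Type*} [Group G] {ι κ : Type*} {σ : G →* Equiv.Perm ι} {τ : G →* Equiv.Perm κ}
variable {c : G → G → ι → Circle} {d : G → G → κ → Circle}

/-- Isomorphisms of graded projective representations with the same obstruction pair: fibrewise
linear isomorphisms (over the identity of the base) commuting with the projective actions. -/
structure Iso (V : GradedProjRep σ c) (V' : GradedProjRep σ c) where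
  toEquiv : ∀ i, V.fibre i ≃ₗ[ℂ] V'.fibre i
  comm : ∀ (g : G) {i j : ι} (h : σ g i = j) (x : V.fibre i),
    toEquiv j (V.Φ g h x) = V'.Φ g h (toEquiv i x)

/-- The tensor product of graded projective representations. -/
noncomputable def tensor (V : GradedProjRep σ c) (V' : GradedProjRep τ d) :
    GradedProjRep (prodPerm σ τ) (fun g h p => c g h p.1 * d g h p.2) where
  fibre p := V.fibre p.1 ⊗[ℂ] V'.fibre p.2
  Φ g _ _ h := TensorProduct.congr (V.Φ g (congrArg Prod.fst h)) (V'.Φ g (congrArg Prod.snd h))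
  Φ_mul g h i j k hi hj hk x := by
    induction x using TensorProduct.induction_on with
    | zero => simp
    | add x y hx hy => simp only [map_add, smul_add, hx, hy]
    | tmul x y =>
      simp only [TensorProduct.congr_tmul]
      rw [V.Φ_mul g h (congrArg Prod.fst hi) (congrArg Prod.fst hj) (congrArg Prod.fst hk),
        V'.Φ_mul g h (congrArg Prod.snd hi) (congrArg Prod.snd hj) (congrArg Prod.snd hk),
        TensorProduct.smul_tmul_smul, Circle.coe_mul]

/-- Relabelling the base of a graded projective representation along a bijection. -/
noncomputable def pullback (V : GradedProjRep σ c) (e : κ ≃ ι) (hσ : ∀ g k, e (τ g k) = σ g (e k))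
    (hc : ∀ g h k, d g h k = c g h (e k)) : GradedProjRep τ d where
  fibre k := V.fibre (e k)
  Φ g i _ h := V.Φ g ((hσ g i).symm.trans (congrArg e h))
  Φ_mul g h i j k hi hj hk x := by
    rw [hc]
    exact V.Φ_mul g h _ _ _ x

end GradedProjRep

/-! ## 1-morphisms between 2-representations -/

namespace TwoRep

variable {G A : Type*} [Group G] [CommGroup A] {ρ : G →* MulAut A}
variable {ι κ ι' κ' : Type*}

/-- A 1-morphism `(σ, c, χ) → (σ', c', χ')`: a graded projective representation with obstruction
pair `(σ ⊗ σ', c̄ ⊗ c')` that is supported on the set of indices `p` with `(χ̄ ⊗ χ')_p = 1`. -/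
structure Hom (X : TwoRep ρ ι) (Y : TwoRep ρ κ) extends
    GradedProjRep.{u} (X.conj.tensor Y).σ (X.conj.tensor Y).c where
  support : ∀ p, Nontrivial (fibre p) → (X.conj.tensor Y).χ p = 1

theorem Hom.support_apply {X : TwoRep ρ ι} {Y : TwoRep ρ κ} (φ : Hom X Y) (i : ι) (j : κ)
    (h : Nontrivial (φ.fibre (i, j))) : (X.χ i)⁻¹ * Y.χ j = 1 :=
  φ.support (i, j) h

/-- The identity 1-morphism: its fibre at `(i, j)` is `ℂ` if `i = j` and `0` otherwise, and `G`
permutes the diagonal fibres. -/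
noncomputable def Hom.id (X : TwoRep ρ ι) : Hom X X where
  fibre p := ↥({ carrier := {z : ℂ | p.1 ≠ p.2 → z = 0}
                 add_mem' := fun ha hb h => by rw [ha h, hb h, add_zero]
                 zero_mem' := fun _ => rfl
                 smul_mem' := fun a z hz h => by rw [hz h, smul_zero] } : Submodule ℂ ℂ)
  Φ g p q h :=
    LinearEquiv.ofEq _ _ (by
      have h1 : X.σ g p.1 = q.1 := congrArg Prod.fst h
      have h2 : X.σ g p.2 = q.2 := congrArg Prod.snd h
      have : p.1 = p.2 ↔ q.1 = q.2 := by rw [← h1, ← h2, (X.σ g).apply_eq_iff_eq]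
      ext z
      change (p.1 ≠ p.2 → z = 0) ↔ (q.1 ≠ q.2 → z = 0)
      rw [ne_eq, ne_eq, this])
  Φ_mul g h p q r hp hq hr x := by
    apply Subtype.ext
    change (x : ℂ) = (((X.c g h r.1)⁻¹ * X.c g h r.2 : Circle) : ℂ) * (x : ℂ)
    by_cases hx : p.1 = p.2
    · have h1 : X.σ (g * h) p.1 = r.1 := congrArg Prod.fst hr
      have h2 : X.σ (g * h) p.2 = r.2 := congrArg Prod.snd hr
      have h3 : r.1 = r.2 := by rw [← h1, ← h2, hx]
      have h4 : (X.c g h r.1)⁻¹ * X.c g h r.2 = 1 := by rw [h3, inv_mul_cancel]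
      rw [h4]
      exact (one_mul _).symm
    · have h0 : (x : ℂ) = 0 := x.2 hx
      simp [h0]
  support p hp := by
    have hx : p.1 = p.2 := by
      by_contra hne
      obtain ⟨x, y, hxy⟩ := hp
      exact hxy (Subtype.ext ((x.2 hne).trans (y.2 hne).symm))
    change (X.χ p.1)⁻¹ * X.χ p.2 = 1
    rw [hx, inv_mul_cancel]

/-- An ordinary representation of `G` as a 1-endomorphism of the trivial 2-representation. -/
noncomputable def Hom.ofRepresentation (ρ : G →* MulAut A) {W : Type u} [AddCommGroup W]
    [Module ℂ W] [FiniteDimensional ℂ W] (ψ : Representation ℂ G W) :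
    Hom.{u} (trivial ρ) (trivial ρ) where
  fibre _ := W
  Φ g _ _ _ := LinearEquiv.ofLinearMap (ψ g) (ψ g⁻¹)
    (by rw [← Module.End.mul_eq_comp, ← map_mul]; simp [Module.End.one_eq_id])
    (by rw [← Module.End.mul_eq_comp, ← map_mul]; simp [Module.End.one_eq_id])
  Φ_mul g h _ _ _ _ _ _ x := by
    change ψ (g * h) x = (((1 : Circle)⁻¹ * 1 : Circle) : ℂ) • ψ g (ψ h x)
    simp
  support _ _ := by
    change (1 : A →* Circle)⁻¹ * 1 = 1
    simp

/-- The fusion `X₁ ⊗ X₃ → X₂ ⊗ X₄` of 1-morphisms `X₁ → X₂` and `X₃ → X₄`: the tensor product of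
graded projective representations, with fibre `V_{(i,j)} ⊗ V'_{(k,l)}` at `((i,k),(j,l))`. -/
noncomputable def Hom.tensor {X₁ : TwoRep ρ ι} {X₂ : TwoRep ρ κ} {X₃ : TwoRep ρ ι'}
    {X₄ : TwoRep ρ κ'} (φ : Hom X₁ X₂) (φ' : Hom X₃ X₄) :
    Hom (X₁.tensor X₃) (X₂.tensor X₄) where
  toGradedProjRep := (φ.toGradedProjRep.tensor φ'.toGradedProjRep).pullback
    (Equiv.prodProdProdComm ι ι' κ κ') (fun _ _ => rfl) (fun g h p => by
      change (X₁.c g h p.1.1 * X₃.c g h p.1.2)⁻¹ * (X₂.c g h p.2.1 * X₄.c g h p.2.2)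
        = ((X₁.c g h p.1.1)⁻¹ * X₂.c g h p.2.1) * ((X₃.c g h p.1.2)⁻¹ * X₄.c g h p.2.2)
      rw [mul_inv, mul_mul_mul_comm])
  support p hp := by
    have hp' : Nontrivial (φ.fibre (p.1.1, p.2.1) ⊗[ℂ] φ'.fibre (p.1.2, p.2.2)) := hp
    have h1 : Nontrivial (φ.fibre (p.1.1, p.2.1)) := by
      by_contra hn
      rw [not_nontrivial_iff_subsingleton] at hn
      exact not_subsingleton _ (tensorProduct_subsingleton_left (φ.fibre (p.1.1, p.2.1))
        (φ'.fibre (p.1.2, p.2.2)))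
    have h2 : Nontrivial (φ'.fibre (p.1.2, p.2.2)) := by
      by_contra hn
      rw [not_nontrivial_iff_subsingleton] at hn
      exact not_subsingleton _ (tensorProduct_subsingleton_right (φ.fibre (p.1.1, p.2.1))
        (φ'.fibre (p.1.2, p.2.2)))
    have e1 : (X₁.χ p.1.1)⁻¹ * X₂.χ p.2.1 = 1 := φ.support_apply _ _ h1
    have e2 : (X₃.χ p.1.2)⁻¹ * X₄.χ p.2.2 = 1 := φ'.support_apply _ _ h2
    change (X₁.χ p.1.1 * X₃.χ p.1.2)⁻¹ * (X₂.χ p.2.1 * X₄.χ p.2.2) = 1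
    rw [mul_inv, mul_mul_mul_comm, e1, e2, one_mul]

/-- Transport of 1-morphisms along relabellings of source and target. -/
noncomputable def Hom.transport {X : TwoRep ρ ι} {Y : TwoRep ρ κ} {X' : TwoRep ρ ι'} {Y' : TwoRep ρ κ'}
    (φ : Hom X Y) (e : StrictIso X X') (f : StrictIso Y Y') : Hom X' Y' where
  toGradedProjRep := φ.toGradedProjRep.pullback
    (Equiv.prodCongr e.toEquiv f.toEquiv).symm
    (fun g p => by
      rw [Equiv.symm_apply_eq]
      refine Prod.ext ?_ ?_
      · change X'.σ g p.1 = e.toEquiv (X.σ g (e.toEquiv.symm p.1))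
        rw [e.σ_comm, Equiv.apply_symm_apply]
      · change Y'.σ g p.2 = f.toEquiv (Y.σ g (f.toEquiv.symm p.2))
        rw [f.σ_comm, Equiv.apply_symm_apply])
    (fun g h p => by
      change (X'.c g h p.1)⁻¹ * Y'.c g h p.2
        = (X.c g h (e.toEquiv.symm p.1))⁻¹ * Y.c g h (f.toEquiv.symm p.2)
      rw [← e.c_comm, ← f.c_comm, Equiv.apply_symm_apply, Equiv.apply_symm_apply])
  support p hp := by
    have e1 : (X.χ (e.toEquiv.symm p.1))⁻¹ * Y.χ (f.toEquiv.symm p.2) = 1 :=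
      φ.support_apply _ _ hp
    change (X'.χ p.1)⁻¹ * Y'.χ p.2 = 1
    rw [← e.χ_comm, ← f.χ_comm, Equiv.apply_symm_apply, Equiv.apply_symm_apply] at e1
    exact e1

/-- The fusion `φ ⊗ ψ : X → Y` of a 1-morphism `φ : X → Y` with an ordinary representation `ψ`
of `G`, viewed as a 1-endomorphism of `𝟏`, using `X ⊗ 𝟏 ≅ X` and `Y ⊗ 𝟏 ≅ Y`. -/
noncomputable def Hom.fuse {X : TwoRep ρ ι} {Y : TwoRep ρ κ} (φ : Hom X Y) {W : Type*}
    [AddCommGroup W] [Module ℂ W] [FiniteDimensional ℂ W] (ψ : Representation ℂ G W) : Hom X Y :=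
  (φ.tensor (Hom.ofRepresentation ρ ψ)).transport X.rightUnitor Y.rightUnitor

end TwoRep

/-! ## Simple 2-representations -/

/-- A 1-dimensional 2-representation `(u, α)` of the sub-2-group `(H, A, ρ|_H)`: an ordinary
2-cocycle `u` on `H` with values in `U(1)` and an `H`-invariant character `α` of `A`. -/
structure OneDimTwoRep {G A : Type*} [Group G] [CommGroup A] (ρ : G →* MulAut A)
    (H : Subgroup G) where
  u : H → H → Circle
  cocycle : ∀ g h k, u h k * u g (h * k) = u (g * h) k * u g h
  α : A →* Circle
  invariant : ∀ (h : H) (a : A), α (ρ h a) = α a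

/-- A choice of representatives of the left cosets of `H` in `G`. -/
structure CosetReps {G : Type*} [Group G] (H : Subgroup G) where
  rep : G ⧸ H → G
  mk_rep : ∀ x, (QuotientGroup.mk (rep x) : G ⧸ H) = x

namespace CosetReps

variable {G : Type*} [Group G] {H : Subgroup G}

/-- The element `h_x(g) ∈ H` determined by `g R_x = R_{g x} h_x(g)`. -/
def elt (R : CosetReps H) (g : G) (x : G ⧸ H) : H :=
  ⟨(R.rep (g • x))⁻¹ * (g * R.rep x), QuotientGroup.eq.1 (by
    rw [R.mk_rep]
    change g • x = g • (QuotientGroup.mk (R.rep x) : G ⧸ H)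
    rw [R.mk_rep])⟩

theorem elt_mul (R : CosetReps H) (g h : G) (x : G ⧸ H) :
    R.elt (g * h) x = R.elt g (h • x) * R.elt h x := by
  apply Subtype.ext
  simp only [elt, Subgroup.coe_mul, mul_smul]
  group

/-- The element `g⁻¹ R_{gH} ∈ H`. -/
def offset (R : CosetReps H) (g : G) : H :=
  ⟨g⁻¹ * R.rep (QuotientGroup.mk g), QuotientGroup.eq.1 (R.mk_rep _).symm⟩

theorem elt_eq (R : CosetReps H) (l : G) (a : G) (ha : l • (QuotientGroup.mk a : G ⧸ H) =
    QuotientGroup.mk a) : (R.elt l (QuotientGroup.mk a) : G)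
      = (R.offset a : G)⁻¹ * (a⁻¹ * l * a) * R.offset a := by
  simp only [elt, offset, ha]
  group

end CosetReps

/-- The simple 2-representation labelled by `(H, u, α)`: the induction `Ind_H(u, α)`, built with
representatives `R` of the left cosets of `H`. -/
noncomputable def OneDimTwoRep.ind {G A : Type*} [Group G] [Finite G] [CommGroup A] {ρ : G →* MulAut A}
    {H : Subgroup G} (X : OneDimTwoRep ρ H) (R : CosetReps H) : TwoRep ρ (G ⧸ H) where
  finite_index := inferInstance
  σ := MulAction.toPermHom G (G ⧸ H)
  c g h x := X.u (R.elt g (g⁻¹ • x)) (R.elt h ((g * h)⁻¹ • x))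
  cocycle g h k x := by
    have hσ : (MulAction.toPermHom G (G ⧸ H) g)⁻¹ x = g⁻¹ • x := by
      rw [← map_inv]; rfl
    have key := X.cocycle (R.elt g (g⁻¹ • x)) (R.elt h ((g * h)⁻¹ • x))
      (R.elt k ((g * h * k)⁻¹ • x))
    have e1 : R.elt g (g⁻¹ • x) * R.elt h ((g * h)⁻¹ • x) = R.elt (g * h) ((g * h)⁻¹ • x) := by
      rw [R.elt_mul]; simp [mul_smul]
    have e2 : R.elt h ((g * h)⁻¹ • x) * R.elt k ((g * h * k)⁻¹ • x)
        = R.elt (h * k) ((g * (h * k))⁻¹ • x) := by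
      rw [R.elt_mul]; simp [mul_smul]
    rw [e1, e2] at key
    rw [hσ]
    simpa [mul_smul, mul_assoc] using key
  χ x := X.α.comp (ρ (R.rep x)⁻¹).toMonoidHom
  equivariant g a x := by
    have hσ : (MulAction.toPermHom G (G ⧸ H) g)⁻¹ x = g⁻¹ • x := by
      rw [← map_inv]; rfl
    rw [hσ]
    change X.α (ρ (R.rep (g⁻¹ • x))⁻¹ a) = X.α (ρ (R.rep x)⁻¹ (ρ g a))
    have h1 : (R.rep (g⁻¹ • x))⁻¹ = (R.elt g⁻¹ x : G) * ((R.rep x)⁻¹ * g) := by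
      simp [CosetReps.elt, mul_assoc]
    rw [h1, map_mul, MulAut.mul_apply, X.invariant, map_mul, MulAut.mul_apply]

/-! ## Projective representations and the components of a 1-morphism -/

/-- A projective representation of `L` with 2-cocycle `w`, in the convention
`φ(l l') = w(l, l') φ(l) φ(l')`. -/
structure ProjRep (L : Type*) [Group L] (w : L → L → Circle) where
  space : Type u
  [addCommGroup : AddCommGroup space]
  [module : Module ℂ space]
  [finiteDimensional : FiniteDimensional ℂ space]
  act : L → (space ≃ₗ[ℂ] space)
  act_mul : ∀ (l l' : L) (x : space), act (l * l') x = ((w l l' : Circle) : ℂ) • act l (act l' x)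

attribute [instance] ProjRep.addCommGroup ProjRep.module ProjRep.finiteDimensional

namespace ProjRep

variable {L L' : Type*} [Group L] [Group L'] {w w' : L → L → Circle}

/-- Isomorphisms of projective representations: linear isomorphisms which intertwine the actions
exactly, not only up to phases. -/
structure Iso (P : ProjRep L w) (Q : ProjRep L w') where
  toEquiv : P.space ≃ₗ[ℂ] Q.space
  comm : ∀ l x, toEquiv (P.act l x) = Q.act l (toEquiv x)

/-- The tensor product of projective representations. -/
noncomputable def tensor (P : ProjRep L w) (Q : ProjRep L w') :
    ProjRep L (fun l l' => w l l' * w' l l') where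
  space := P.space ⊗[ℂ] Q.space
  act l := TensorProduct.congr (P.act l) (Q.act l)
  act_mul l l' x := by
    induction x using TensorProduct.induction_on with
    | zero => simp
    | add x y hx hy => simp only [map_add, smul_add, hx, hy]
    | tmul x y =>
      simp only [TensorProduct.congr_tmul]
      rw [P.act_mul, Q.act_mul, TensorProduct.smul_tmul_smul, Circle.coe_mul]

/-- Restriction along a group homomorphism. -/
noncomputable def res (P : ProjRep L w) (θ : L' →* L) : ProjRep L' (fun l l' => w (θ l) (θ l')) where
  space := P.space
  act l := P.act (θ l)
  act_mul l l' x := by rw [map_mul, P.act_mul]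

/-- An ordinary representation as a projective representation with trivial cocycle. -/
noncomputable def ofRepresentation {W : Type u} [AddCommGroup W] [Module ℂ W]
    [FiniteDimensional ℂ W] (ψ : Representation ℂ L W) : ProjRep.{u} L (fun _ _ => 1) where
  space := W
  act l := LinearEquiv.ofLinearMap (ψ l) (ψ l⁻¹)
    (by rw [← Module.End.mul_eq_comp, ← map_mul]; simp [Module.End.one_eq_id])
    (by rw [← Module.End.mul_eq_comp, ← map_mul]; simp [Module.End.one_eq_id])
  act_mul l l' x := by simp

end ProjRep

/-- The subgroup `H ∩ gKg⁻¹`. -/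
def interConj {G : Type*} [Group G] (H K : Subgroup G) (g : G) : Subgroup G :=
  H ⊓ K.map (MulAut.conj g).toMonoidHom

namespace interConj

variable {G : Type*} [Group G] {H K : Subgroup G} {g : G}

/-- The inclusion `H ∩ gKg⁻¹ → H`. -/
def toLeft (H K : Subgroup G) (g : G) : interConj H K g →* H :=
  Subgroup.inclusion inf_le_left

/-- The homomorphism `H ∩ gKg⁻¹ → K`, `l ↦ g⁻¹ l g`. -/
def toRight (H K : Subgroup G) (g : G) : interConj H K g →* K where
  toFun l := ⟨g⁻¹ * (l : G) * g, by
    obtain ⟨k, hk, hkl⟩ := l.2.2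
    have : g * k * g⁻¹ = (l : G) := hkl
    rw [← this]
    simpa [mul_assoc] using hk⟩
  map_one' := by ext; simp
  map_mul' l l' := by ext; simp [mul_assoc]

/-- The inclusion `H → H ∩ eHe⁻¹`, which is an isomorphism. -/
def ofSelf (H : Subgroup G) : H →* interConj H H 1 :=
  Subgroup.inclusion (fun h hh => ⟨hh, h, hh, by simp⟩)

theorem smul_left (l : interConj H K g) :
    (l : G) • (QuotientGroup.mk 1 : G ⧸ H) = QuotientGroup.mk 1 := by
  change (QuotientGroup.mk ((l : G) * 1) : G ⧸ H) = QuotientGroup.mk 1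
  rw [QuotientGroup.eq]
  simpa using l.2.1

theorem smul_right (l : interConj H K g) :
    (l : G) • (QuotientGroup.mk g : G ⧸ K) = QuotientGroup.mk g := by
  change (QuotientGroup.mk ((l : G) * g) : G ⧸ K) = QuotientGroup.mk g
  rw [eq_comm, QuotientGroup.eq, ← mul_assoc]
  exact (toRight H K g l).2

end interConj

namespace OneDimTwoRep

variable {G A : Type*} [Group G] [CommGroup A] {ρ : G →* MulAut A}
variable {H K : Subgroup G}

/-- The phase `u(r, r⁻¹hr) / u(h, r)`. It compares `u` with its conjugate by `r ∈ H`: if `U`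
satisfies `U_{hh'} = u(h,h') U_h U_{h'}`, then `U_r⁻¹ U_h U_r` is this phase times `U_{r⁻¹hr}`. -/
noncomputable def phase (X : OneDimTwoRep ρ H) (r h : H) : Circle := X.u r (r⁻¹ * h * r) / X.u h r

theorem phase_mul (X : OneDimTwoRep ρ H) (r h k : H) :
    X.phase r (h * k) * X.u (r⁻¹ * h * r) (r⁻¹ * k * r)
      = X.u h k * (X.phase r h * X.phase r k) := by
  have c1 := X.cocycle r (r⁻¹ * h * r) (r⁻¹ * k * r)
  have c2 := X.cocycle h r (r⁻¹ * k * r)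
  have c3 := X.cocycle h k r
  have e1 : r⁻¹ * h * r * (r⁻¹ * k * r) = r⁻¹ * (h * k) * r := by group
  have e2 : r * (r⁻¹ * h * r) = h * r := by group
  have e3 : r * (r⁻¹ * k * r) = k * r := by group
  rw [e1, e2] at c1
  rw [e3] at c2
  simp only [phase]
  have d1 := congrArg (fun z : Circle => (z : ℂ)) c1
  have d2 := congrArg (fun z : Circle => (z : ℂ)) c2
  have d3 := congrArg (fun z : Circle => (z : ℂ)) c3
  apply Circle.ext
  simp only [Circle.coe_mul, Circle.coe_div] at d1 d2 d3 ⊢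
  have n0 := Circle.coe_ne_zero (X.u (h * k) r)
  have n1 := Circle.coe_ne_zero (X.u h r)
  have n2 := Circle.coe_ne_zero (X.u k r)
  rw [div_mul_eq_mul_div, div_mul_div_comm, ← mul_div_assoc, div_eq_div_iff n0 (mul_ne_zero n1 n2)]
  have n3 := Circle.coe_ne_zero (X.u h (k * r))
  apply mul_left_cancel₀ n3
  linear_combination (X.u h r * X.u k r * X.u h (k * r) : ℂ) * d1
    - (X.u r (r⁻¹ * h * r) * X.u k r * X.u h (k * r) : ℂ) * d2
    + (X.u r (r⁻¹ * h * r) * X.u r (r⁻¹ * k * r) * X.u h (k * r) : ℂ) * d3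

/-- The 2-cocycle `ū ⊗ ᵍv` on `H ∩ gKg⁻¹`, where `(ᵍv)(l, l') = v(g⁻¹lg, g⁻¹l'g)`. -/
noncomputable def homCocycle (X : OneDimTwoRep ρ H) (Y : OneDimTwoRep ρ K) (g : G)
    (l l' : interConj H K g) : Circle :=
  (X.u (interConj.toLeft H K g l) (interConj.toLeft H K g l'))⁻¹
    * Y.u (interConj.toRight H K g l) (interConj.toRight H K g l')

end OneDimTwoRep

theorem phase_aux {M : Type*} [CommGroup M] {p a u x x' q b v y y' : M}
    (h1 : p * a = u * (x * x')) (h2 : q * b = v * (y * y')) :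
    p⁻¹ * q * (a⁻¹ * b) = u⁻¹ * v * (x'⁻¹ * y' * (x⁻¹ * y)) := by
  have h3 : p⁻¹ * q * (a⁻¹ * b) = (p * a)⁻¹ * (q * b) := by
    rw [mul_mul_mul_comm, mul_inv]
  rw [h3, h1, h2, mul_inv, mul_inv, mul_mul_mul_comm, mul_mul_mul_comm x⁻¹ x'⁻¹ y y',
    mul_comm (x⁻¹ * y)]

/-- The 2-cocycle of `Ind_H(u, α)` at a coset `aH`, evaluated on elements stabilising it. -/
theorem OneDimTwoRep.ind_c_eq {G A : Type*} [Group G] [Finite G] [CommGroup A]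
    {ρ : G →* MulAut A} {H : Subgroup G} (X : OneDimTwoRep ρ H) (R : CosetReps H) (a l l' : G)
    (h h' : H) (hl : l • (QuotientGroup.mk a : G ⧸ H) = QuotientGroup.mk a)
    (hl' : l' • (QuotientGroup.mk a : G ⧸ H) = QuotientGroup.mk a)
    (eh : (h : G) = a⁻¹ * l * a) (eh' : (h' : G) = a⁻¹ * l' * a) :
    (X.ind R).c l l' (QuotientGroup.mk a)
      = X.u ((R.offset a)⁻¹ * h * R.offset a) ((R.offset a)⁻¹ * h' * R.offset a) := by
  have e1 : l⁻¹ • (QuotientGroup.mk a : G ⧸ H) = QuotientGroup.mk a := by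
    rw [inv_smul_eq_iff, hl]
  have e2 : (l * l')⁻¹ • (QuotientGroup.mk a : G ⧸ H) = QuotientGroup.mk a := by
    rw [inv_smul_eq_iff, mul_smul, hl', hl]
  change X.u (R.elt l (l⁻¹ • _)) (R.elt l' ((l * l')⁻¹ • _)) = _
  rw [e1, e2]
  congr 1 <;> apply Subtype.ext
  · rw [R.elt_eq l a hl, ← eh]; rfl
  · rw [R.elt_eq l' a hl', ← eh']; rfl

/-- `H ∩ gKg⁻¹` stabilises the pair of cosets `(eH, gK)`. -/
theorem interConj.fixes {G A : Type*} [Group G] [Finite G] [CommGroup A]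
    {ρ : G →* MulAut A} {H K : Subgroup G} (X : OneDimTwoRep ρ H) (Y : OneDimTwoRep ρ K)
    (R : CosetReps H) (S : CosetReps K) (g : G) (l : interConj H K g) :
    ((X.ind R).conj.tensor (Y.ind S)).σ (l : G) (QuotientGroup.mk 1, QuotientGroup.mk g)
      = (QuotientGroup.mk 1, QuotientGroup.mk g) :=
  Prod.ext (interConj.smul_left l) (interConj.smul_right l)

/-- The component `φ_g` of a 1-morphism `φ : (H, u, α) → (K, v, β)` at `g ∈ G`, as a projective
representation of `H ∩ gKg⁻¹` with 2-cocycle `ū ⊗ ᵍv`. It is the fibre at the pair of cosets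
`(eH, gK)`, whose stabiliser is `H ∩ gKg⁻¹`, with the action of this stabiliser. The phases account
for the chosen coset representatives; they are `1` if `eH` and `gK` are represented by `e` and
`g`. -/
noncomputable def TwoRep.Hom.component {G A : Type*} [Group G] [Finite G] [CommGroup A]
    {ρ : G →* MulAut A} {H K : Subgroup G} {X : OneDimTwoRep ρ H} {Y : OneDimTwoRep ρ K}
    {R : CosetReps H} {S : CosetReps K} (φ : TwoRep.Hom.{u} (X.ind R) (Y.ind S)) (g : G) :
    ProjRep.{u} (interConj H K g) (X.homCocycle Y g) where
  space := φ.fibre (QuotientGroup.mk 1, QuotientGroup.mk g)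
  act l := (φ.Φ (l : G) (interConj.fixes X Y R S g l)).trans
    (LinearEquiv.smulOfNeZero ℂ _
      (((X.phase (R.offset 1) (interConj.toLeft H K g l))⁻¹
        * Y.phase (S.offset g) (interConj.toRight H K g l) : Circle) : ℂ) (Circle.coe_ne_zero _))
  act_mul l l' x := by
    have hX := X.ind_c_eq R 1 l l' (interConj.toLeft H K g l) (interConj.toLeft H K g l')
      (interConj.smul_left l) (interConj.smul_left l')
      (by rw [inv_one, one_mul, mul_one]; rfl) (by rw [inv_one, one_mul, mul_one]; rfl)
    have hY := Y.ind_c_eq S g l l' (interConj.toRight H K g l) (interConj.toRight H K g l')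
      (interConj.smul_right l) (interConj.smul_right l') rfl rfl
    have pX := X.phase_mul (R.offset 1) (interConj.toLeft H K g l) (interConj.toLeft H K g l')
    have pY := Y.phase_mul (S.offset g) (interConj.toRight H K g l) (interConj.toRight H K g l')
    rw [← hX] at pX
    rw [← hY] at pY
    have hΦ := φ.Φ_mul (l : G) (l' : G) (interConj.fixes X Y R S g l')
      (interConj.fixes X Y R S g l) (interConj.fixes X Y R S g (l * l')) x
    simp only [LinearEquiv.trans_apply, LinearEquiv.smulOfNeZero_apply, map_smul, smul_smul]
    refine (congrArg _ hΦ).trans ?_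
    rw [smul_smul]
    congr 1
    rw [← Circle.coe_mul, ← Circle.coe_mul, ← Circle.coe_mul]
    congr 1
    change _ * (((X.ind R).c l l' (QuotientGroup.mk 1))⁻¹ * (Y.ind S).c l l' (QuotientGroup.mk g))
      = _
    rw [map_mul, map_mul, OneDimTwoRep.homCocycle]
    exact phase_aux pX pY

/-! The fibre of `φ.fuse ψ` at `(i, j)` is that of `φ` tensored with `W`, and `g` acts by `Φ_g ⊗
ψ(g)`. Passing to a component restricts this to the stabiliser of `(eH, gK)` and multiplies by a
phase that does not involve `ψ`. So the isomorphism with the tensor product of representations is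
the identity map of the fibre, with the phase moved onto the first factor (`fuseComponentIso`).

That components determine a 1-morphism is a fact about equivariant bundles. The orbits of `G` on
`G/H × G/K` correspond to the double cosets `H\G/K`, and the stabiliser of `(eH, gK)` is `H ∩
gKg⁻¹`. An isomorphism of fibres at an orbit representative is carried to the rest of the orbit by
conjugation with `Φ_g`. The result is independent of `g` because the given isomorphism commutes with
the stabiliser, and the projective phases do no harm because both bundles have the same cocycle
(`conjEquiv_comm`, `nonempty_iso_of_orbit_representatives`).

For the identity 1-morphism, the fibre at `(eH, gH)` is `ℂ` or `0` according to whether `g ∈ H`. At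
`g = e` the two phases are inverse to each other, so `ℂ ⊗ W ≅ W` intertwines the actions exactly. -/

/-- Pure tensors span. The pointwise form, with the modules and maps open to being named, serves
spaces that are tensor products only after unfolding definitions. -/
theorem tensorProduct_congr_fun {M N P : Type*} [AddCommGroup M] [AddCommGroup N]
    [AddCommGroup P] [Module ℂ M] [Module ℂ N] [Module ℂ P] {f f' : M ⊗[ℂ] N →ₗ[ℂ] P}
    (h : ∀ x y, f (x ⊗ₜ y) = f' (x ⊗ₜ y)) (z : M ⊗[ℂ] N) : f z = f' z := by
  rw [TensorProduct.ext' h]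

/-! ### Extending isomorphisms from orbit representatives -/

namespace GradedProjRep

variable {G : Type*} [Group G] {ι Q : Type*} {σ : G →* Equiv.Perm ι} {c : G → G → ι → Circle}

/-- Conjugating a linear isomorphism of the fibres at `p` by the action of `g` gives a linear
isomorphism of the fibres at `σ_g(p)`. -/
noncomputable def conjEquiv (V V' : GradedProjRep σ c) {p i : ι}
    (f : V.fibre p ≃ₗ[ℂ] V'.fibre p) (g : G) (h : σ g p = i) : V.fibre i ≃ₗ[ℂ] V'.fibre i :=
  ((V.Φ g h).symm.trans f).trans (V'.Φ g h)

theorem conjEquiv_apply_Φ (V V' : GradedProjRep σ c) {p i : ι}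
    (f : V.fibre p ≃ₗ[ℂ] V'.fibre p) (g : G) (h : σ g p = i) (x : V.fibre p) :
    conjEquiv V V' f g h (V.Φ g h x) = V'.Φ g h (f x) := by
  simp [conjEquiv]

/-- If `f` commutes with the stabiliser of `p`, then `conjEquiv V V' f g` depends only on
`σ_g(p)`. -/
theorem conjEquiv_comm (V V' : GradedProjRep σ c) {p : ι} (f : V.fibre p ≃ₗ[ℂ] V'.fibre p)
    (hf : ∀ (l : G) (hl : σ l p = p) (x : V.fibre p), f (V.Φ l hl x) = V'.Φ l hl (f x))
    (g : G) {i : ι} (hg : σ g p = i) (g' : G) (hg' : σ g' p = i) (x : V.fibre p) :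
    conjEquiv V V' f g hg (V.Φ g' hg' x) = V'.Φ g' hg' (f x) := by
  -- Two elements carrying `p` to the same point differ by an element `l` of the stabiliser of `p`.
  obtain ⟨l, rfl⟩ : ∃ l, g' = g * l := ⟨g⁻¹ * g', by group⟩
  have hl : σ l p = p := by
    apply (σ g).injective
    rw [hg, ← hg', map_mul, Equiv.Perm.mul_apply]
  -- Splitting `Φ_{gl}` produces the phase `c_i(g, l)` on both sides, since `V` and `V'` share the
  -- cocycle; `hf` then moves `f` past the action of `l`.
  rw [V.Φ_mul g l hl hg hg', V'.Φ_mul g l hl hg hg', map_smul, conjEquiv_apply_Φ, hf]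

/-- Let `t` be a system of representatives of the `G`-orbits of the base. Isomorphisms of the
fibres at the representatives that commute with the actions of the stabilisers extend to an
isomorphism of graded projective representations. -/
theorem nonempty_iso_of_orbit_representatives (V V' : GradedProjRep σ c) (t : Q → ι)
    (cover : ∀ i, ∃ a g, σ g (t a) = i)
    (separated : ∀ a b g g', σ g (t a) = σ g' (t b) → a = b)
    (f : ∀ a, V.fibre (t a) ≃ₗ[ℂ] V'.fibre (t a))
    (hf : ∀ (a : Q) (l : G) (hl : σ l (t a) = t a) (x : V.fibre (t a)),
      f a (V.Φ l hl x) = V'.Φ l hl (f a x)) :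
    Nonempty (Iso V V') := by
  choose a r hr using cover
  refine ⟨⟨fun i => conjEquiv V V' (f (a i)) (r i) (hr i), fun g i j h x => ?_⟩⟩
  -- Every vector over `i` comes from the fibre at the representative of its orbit, where the
  -- isomorphism is given.
  obtain ⟨y, rfl⟩ := (V.Φ (r i) (hr i)).surjective x
  -- Both `r j` and `g * r i` reach `j` from a representative, so the representatives coincide.
  have hab : a j = a i := separated _ _ (r j) (g * r i) (by
    rw [hr, map_mul, Equiv.Perm.mul_apply, hr, h])
  have hgr : σ (g * r i) (t (a i)) = j := by rw [map_mul, Equiv.Perm.mul_apply, hr, h]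
  -- The fibres and `f` depend on `a j`, so the equality `a j = a i` is used on a free variable `b`
  -- rather than by rewriting. The content is that `r j` and `g * r i` transport `f (a i)` to the
  -- same map over `j`.
  have key : ∀ (b : Q) (hb : σ (r j) (t b) = j), b = a i →
      conjEquiv V V' (f b) (r j) hb (V.Φ (g * r i) hgr y) = V'.Φ (g * r i) hgr (f (a i) y) := by
    rintro b hb rfl
    exact conjEquiv_comm V V' _ (hf _) _ hb _ hgr y
  have := key (a j) (hr j) hab
  rw [V.Φ_mul g (r i) (hr i) h hgr, V'.Φ_mul g (r i) (hr i) h hgr, map_smul] at this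
  rw [conjEquiv_apply_Φ]
  -- The common phase from splitting `Φ_{g r_i}` is nonzero and cancels.
  exact smul_right_injective _ (Circle.coe_ne_zero (c g (r i) j)) this

end GradedProjRep

/-! ### Inverses and composites of isomorphisms of projective representations -/

namespace ProjRep.Iso

variable {L : Type*} [Group L] {w w' w'' : L → L → Circle}

/-- The inverse of an isomorphism of projective representations. -/
noncomputable def symm {P : ProjRep L w} {P' : ProjRep L w'} (e : Iso P P') : Iso P' P where
  toEquiv := e.toEquiv.symm
  comm l x := by rw [LinearEquiv.symm_apply_eq, e.comm, LinearEquiv.apply_symm_apply]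

/-- The composite of isomorphisms of projective representations. -/
noncomputable def trans {P : ProjRep L w} {P' : ProjRep L w'} {P'' : ProjRep L w''}
    (e : Iso P P') (e' : Iso P' P'') : Iso P P'' where
  toEquiv := e.toEquiv.trans e'.toEquiv
  comm l x := by simp only [LinearEquiv.trans_apply, e.comm, e'.comm]

end ProjRep.Iso

/-! ### Orbits and stabilisers on pairs of cosets -/

/-- Converse of `interConj.fixes`: the component at `g` records the action of the whole stabiliser
of `(eH, gK)`, so an isomorphism of components commutes with all of it. -/
theorem interConj.mem_of_smul {G : Type*} [Group G] {H K : Subgroup G} {g l : G}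
    (h₁ : l • (QuotientGroup.mk 1 : G ⧸ H) = QuotientGroup.mk 1)
    (h₂ : l • (QuotientGroup.mk g : G ⧸ K) = QuotientGroup.mk g) : l ∈ interConj H K g := by
  have h₁' : (QuotientGroup.mk 1 : G ⧸ H) = QuotientGroup.mk (l * 1) := h₁.symm
  have h₂' : (QuotientGroup.mk g : G ⧸ K) = QuotientGroup.mk (l * g) := h₂.symm
  rw [QuotientGroup.eq] at h₁' h₂'
  refine ⟨by simpa using h₁', g⁻¹ * (l * g), h₂', ?_⟩
  simp [mul_assoc]

namespace DoubleCoset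

variable {G : Type*} [Group G] {H K : Subgroup G}

/-- Every pair of cosets is a translate of `(eH, gK)` for a representative `g` of a double
coset. -/
theorem exists_smul_eq (T : Quotient (H : Set G) (K : Set G) → G) (hT : ∀ q, mk H K (T q) = q)
    (p : (G ⧸ H) × (G ⧸ K)) : ∃ q, ∃ g : G,
      ((g • (QuotientGroup.mk 1 : G ⧸ H), g • (QuotientGroup.mk (T q) : G ⧸ K)) :
        (G ⧸ H) × (G ⧸ K)) = p := by
  obtain ⟨x, y⟩ := p
  induction x using QuotientGroup.induction_on with | _ x => ?_
  induction y using QuotientGroup.induction_on with | _ y => ?_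
  obtain ⟨h, hh, k, hk, e⟩ := (DoubleCoset.eq H K _ _).1 (hT (mk H K (x⁻¹ * y)))
  -- Translating by `x⁻¹` turns `(xH, yK)` into `(eH, x⁻¹yK)`. With `x⁻¹y = h T k`, the element `xh`
  -- sends `eH` to `xH` and `TK` to `xhTK = yK`.
  refine ⟨mk H K (x⁻¹ * y), x * h, Prod.ext ?_ ?_⟩
  · change (QuotientGroup.mk (x * h * 1) : G ⧸ H) = QuotientGroup.mk x
    rw [eq_comm, QuotientGroup.eq]
    simpa using hh
  · change (QuotientGroup.mk (x * h * _) : G ⧸ K) = QuotientGroup.mk y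
    rw [QuotientGroup.eq]
    have : y = x * (h * T (mk H K (x⁻¹ * y)) * k) := by rw [← e]; group
    have e' : (x * h * T (mk H K (x⁻¹ * y)))⁻¹ * y = k := by
      rw [inv_mul_eq_iff_eq_mul]
      refine this.trans ?_
      group
    rw [e']
    exact hk

/-- The double coset of `a` is determined by the orbit of the pair of cosets `(eH, aK)`. -/
theorem mk_eq_of_smul_eq {a b g g' : G}
    (h₁ : g • (QuotientGroup.mk 1 : G ⧸ H) = g' • (QuotientGroup.mk 1 : G ⧸ H))
    (h₂ : g • (QuotientGroup.mk a : G ⧸ K) = g' • (QuotientGroup.mk b : G ⧸ K)) :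
    mk H K a = mk H K b := by
  have h₁' : (QuotientGroup.mk (g' * 1) : G ⧸ H) = QuotientGroup.mk (g * 1) := h₁.symm
  have h₂' : (QuotientGroup.mk (g * a) : G ⧸ K) = QuotientGroup.mk (g' * b) := h₂
  rw [QuotientGroup.eq] at h₁' h₂'
  -- The witnesses solve `b = h a k`: `h = g'⁻¹g` lies in `H` by `h₁'`, and `k = (ga)⁻¹(g'b)` lies
  -- in `K` by `h₂'`.
  exact (DoubleCoset.eq H K a b).2
    ⟨g'⁻¹ * g, by simpa using h₁', (g * a)⁻¹ * (g' * b), h₂', by group⟩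

end DoubleCoset

/-! ### Components of fusions and of the identity -/

namespace TwoRep.Hom

variable {G A : Type*} [Group G] [Finite G] [CommGroup A] {ρ : G →* MulAut A} {H K : Subgroup G}
variable {X : OneDimTwoRep ρ H} {Y : OneDimTwoRep ρ K} {R : CosetReps H} {S : CosetReps K}

/-- The components of `φ ⊗ ψ` are the components of `φ` tensored with the restrictions of `ψ`. -/
noncomputable def fuseComponentIso (φ : Hom (X.ind R) (Y.ind S)) {W : Type*} [AddCommGroup W]
    [Module ℂ W] [FiniteDimensional ℂ W] (ψ : Representation ℂ G W) (g : G) :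
    ProjRep.Iso ((φ.fuse ψ).component g)
      ((φ.component g).tensor ((ProjRep.ofRepresentation ψ).res (interConj H K g).subtype)) where
  toEquiv := LinearEquiv.refl ℂ
    (φ.fibre (QuotientGroup.mk 1, QuotientGroup.mk g) ⊗[ℂ] W)
  comm l x := by
    refine tensorProduct_congr_fun
      (M := φ.fibre (QuotientGroup.mk 1, QuotientGroup.mk g)) (N := W)
      (f := (((φ.fuse ψ).component g).act l).toLinearMap)
      (f' := (((φ.component g).tensor
        ((ProjRep.ofRepresentation ψ).res (interConj H K g).subtype)).act l).toLinearMap)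
      (fun x y => ?_) x
    -- On pure tensors the two actions differ only in whether the component phase scales the whole
    -- tensor or its first factor.
    exact TensorProduct.smul_tmul' _ _ _

/-- Two 1-morphisms between simple 2-representations are isomorphic if their components at a
system of representatives of the double cosets are. -/
theorem nonempty_iso_of_component (φ θ : Hom (X.ind R) (Y.ind S))
    (T : DoubleCoset.Quotient (H : Set G) (K : Set G) → G)
    (hT : ∀ q, DoubleCoset.mk H K (T q) = q)
    (h : ∀ q, Nonempty (ProjRep.Iso (θ.component (T q)) (φ.component (T q)))) :
    Nonempty (GradedProjRep.Iso θ.toGradedProjRep φ.toGradedProjRep) := by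
  refine GradedProjRep.nonempty_iso_of_orbit_representatives _ _
    (fun q => (QuotientGroup.mk 1, QuotientGroup.mk (T q)))
    (DoubleCoset.exists_smul_eq T hT)
    (fun a b g g' e => ?_) (fun q => (h q).some.toEquiv) (fun q l hl x => ?_)
  · rw [← hT a, ← hT b]
    exact DoubleCoset.mk_eq_of_smul_eq (congrArg Prod.fst e) (congrArg Prod.snd e)
  · have key := (h q).some.comm
      ⟨l, interConj.mem_of_smul (congrArg Prod.fst hl) (congrArg Prod.snd hl)⟩ x
    -- The phase in a component depends on the 2-representations, the coset representatives and `l`,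
    -- but not on the 1-morphism. It is therefore the same for `θ` and `φ` and cancels, leaving the
    -- relation for the bare `Φ_l`.
    exact smul_right_injective _ (Circle.coe_ne_zero _) ((map_smul _ _ _).symm.trans key)

/-- The components of the identity 1-morphism fused with `ψ` vanish away from `H`. -/
theorem subsingleton_id_fuse_component {W : Type*} [AddCommGroup W]
    [Module ℂ W] [FiniteDimensional ℂ W] (ψ : Representation ℂ G W) {g : G} (hg : g ∉ H) :
    Subsingleton (((Hom.id (X.ind R)).fuse ψ).component g).space := by
  have hne : (QuotientGroup.mk 1 : G ⧸ H) ≠ QuotientGroup.mk g := by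
    rw [ne_eq, QuotientGroup.eq]
    simpa using hg
  have : Subsingleton ((Hom.id (X.ind R)).fibre (QuotientGroup.mk 1, QuotientGroup.mk g)) :=
    ⟨fun x y => Subtype.ext ((x.2 hne).trans (y.2 hne).symm)⟩
  exact tensorProduct_subsingleton_left
    ((Hom.id (X.ind R)).fibre (QuotientGroup.mk 1, QuotientGroup.mk g)) W

/-- The diagonal fibres of the identity 1-morphism are `ℂ`. -/
def idFibreEquiv (X : OneDimTwoRep ρ H) (R : CosetReps H) (x : G ⧸ H) :
    (Hom.id (X.ind R)).fibre (x, x) ≃ₗ[ℂ] ℂ :=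
  -- The condition cutting out the fibre inside `ℂ` is vacuous on the diagonal.
  LinearEquiv.ofTop _ (eq_top_iff.2 fun _ _ h => (h rfl).elim)

/-- The component at `e` of the identity 1-morphism fused with `ψ` is the restriction of `ψ`. -/
noncomputable def idFuseComponentIso (X : OneDimTwoRep ρ H) (R : CosetReps H) {W : Type*}
    [AddCommGroup W] [Module ℂ W] [FiniteDimensional ℂ W] (ψ : Representation ℂ G W) :
    ProjRep.Iso ((((Hom.id (X.ind R)).fuse ψ).component 1).res (interConj.ofSelf H))
      ((ProjRep.ofRepresentation ψ).res H.subtype) where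
  toEquiv := (TensorProduct.congr (idFibreEquiv X R (QuotientGroup.mk 1))
    (LinearEquiv.refl ℂ W)).trans (TensorProduct.lid ℂ W)
  comm l x := by
    have hl : interConj.toRight H H 1 (interConj.ofSelf H l) = l := by
      apply Subtype.ext
      change (1 : G)⁻¹ * (l : G) * 1 = l
      simp
    -- Source and target have the same cocycle and coset representatives, and conjugation by `e` is
    -- trivial. The two phases thus cancel for any choice of representatives, even when `eH` is not
    -- represented by `e`.
    have hphase : (X.phase (R.offset 1) (interConj.toLeft H H 1 (interConj.ofSelf H l)))⁻¹
        * X.phase (R.offset 1) (interConj.toRight H H 1 (interConj.ofSelf H l)) = 1 := by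
      rw [hl]
      exact inv_mul_cancel _
    let a : (Hom.id (X.ind R)).fibre (QuotientGroup.mk 1, QuotientGroup.mk 1) ⊗[ℂ] W ≃ₗ[ℂ]
        (Hom.id (X.ind R)).fibre (QuotientGroup.mk 1, QuotientGroup.mk 1) ⊗[ℂ] W :=
      (((Hom.id (X.ind R)).fuse ψ).component 1).act (interConj.ofSelf H l)
    let e : (Hom.id (X.ind R)).fibre (QuotientGroup.mk 1, QuotientGroup.mk 1) ⊗[ℂ] W ≃ₗ[ℂ] W :=
      (TensorProduct.congr (idFibreEquiv X R (QuotientGroup.mk 1))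
        (LinearEquiv.refl ℂ W)).trans (TensorProduct.lid ℂ W)
    let b : W ≃ₗ[ℂ] W := (ProjRep.ofRepresentation ψ).act (l : G)
    refine tensorProduct_congr_fun (f := (a.trans e).toLinearMap) (f' := (e.trans b).toLinearMap)
      (fun x y => ?_) x
    change e ((((X.phase (R.offset 1) (interConj.toLeft H H 1 (interConj.ofSelf H l)))⁻¹
          * X.phase (R.offset 1) (interConj.toRight H H 1 (interConj.ofSelf H l)) : Circle) : ℂ)
        • (((Hom.id (X.ind R)).Φ (l : G)
          (interConj.fixes X X R R 1 (interConj.ofSelf H l)) x) ⊗ₜ[ℂ] ψ (l : G) y))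
      = ψ (l : G) (idFibreEquiv X R (QuotientGroup.mk 1) x • y)
    rw [hphase, Circle.coe_one, one_smul, map_smul]
    -- The identity 1-morphism moves diagonal fibres without changing the underlying complex number.
    rfl

end TwoRep.Hom

theorem mainTheorem8 {G A : Type*} [Group G] [Finite G] [CommGroup A] [Finite A]
    (ρ : G →* MulAut A) {H K : Subgroup G} (X : OneDimTwoRep ρ H) (Y : OneDimTwoRep ρ K)
    (R : CosetReps H) (S : CosetReps K)
    {W : Type*} [AddCommGroup W] [Module ℂ W] [FiniteDimensional ℂ W]
    (ψ : Representation ℂ G W) :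
    (∀ φ : TwoRep.Hom (X.ind R) (Y.ind S),
      (∀ g : G, Nonempty (ProjRep.Iso ((φ.fuse ψ).component g)
        ((φ.component g).tensor ((ProjRep.ofRepresentation ψ).res (interConj H K g).subtype)))) ∧
      (∀ T : DoubleCoset.Quotient (H : Set G) (K : Set G) → G,
        (∀ q, DoubleCoset.mk H K (T q) = q) →
        ∀ θ : TwoRep.Hom (X.ind R) (Y.ind S),
          (∀ q, Nonempty (ProjRep.Iso (θ.component (T q)) ((φ.component (T q)).tensor
            ((ProjRep.ofRepresentation ψ).res (interConj H K (T q)).subtype)))) →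
          Nonempty (GradedProjRep.Iso θ.toGradedProjRep (φ.fuse ψ).toGradedProjRep))) ∧
    Nonempty (ProjRep.Iso
      ((((TwoRep.Hom.id (X.ind R)).fuse ψ).component 1).res (interConj.ofSelf H))
      ((ProjRep.ofRepresentation ψ).res H.subtype)) ∧
    (∀ g : G, g ∉ H →
      Subsingleton (((TwoRep.Hom.id (X.ind R)).fuse ψ).component g).space) := by
  refine ⟨fun φ => ⟨fun g => ⟨φ.fuseComponentIso ψ g⟩, fun T hT θ h => ?_⟩,
    ⟨TwoRep.Hom.idFuseComponentIso X R ψ⟩,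
    fun g hg => TwoRep.Hom.subsingleton_id_fuse_component ψ hg⟩
  -- The given isomorphism of components is composed with the inverse of `fuseComponentIso`, which
  -- reduces the claim to equality of components up to isomorphism.
  exact TwoRep.Hom.nonempty_iso_of_component _ θ T hT fun q =>
    ⟨(h q).some.trans (φ.fuseComponentIso ψ (T q)).symm⟩
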